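/- Notation. For $\mathbf M\in\mathbb C^{m\times n}$ and $k\in\{1,\dots,n\}$ let $\tilde\sigma_{\mathbf M}(k)=\min_{\mathbf P}\operatorname{rank}(\mathbf M\mathbf P)$, where $\mathbf P$ ranges over the matrices consisting of $k$ different columns of the $n\times n$ identity matrix. A *rank expansion lower bound* for $\mathbf M$ is a continuous, nonnegative, (weakly) increasing function $\sigma$ on $[0,\infty)$ with $\sigma(k)\le\tilde\sigma_{\mathbf M}(k)$ for all $k\in\{1,\dots,n\}$. A function $f$ is *log-log convex* on an interval of $(0,\infty)$ if it is positive there and $\ln f$ is a convex function of $\ln x$. **Theorem.** Let $\sigma_A,\sigma_B$ be concave rank expansion lower bounds for $\mathbf A\in\mathbb C^{m_A\times n_A}$ and $\mathbf B\in\mathbb C^{m_B\times n_B}$ with $\sigma_A(0)=\sigma_B(0)=0$. Put $r_A=\sigma_A(n_A)$, $r_B=\sigma_B(n_B)$, $d_A=\sup\{k\ge 0:\sigma_A(k)\le 1\}$, $d_B=\sup\{k\ge 0:\sigma_B(k)\le 1\}$, and assume that $d_A\le n_A$ and $d_B\le n_B$ (in particular, $d_A$ and $d_B$ are finite). For $k\in[0,n_An_B]$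 define $$R_C(k)=\min_{\substack{k_A\in[d_A,n_A],\ k_B\in[d_B,n_B]\\ k_Ak_B\ge k}}\sigma_A(k_A)\,\sigma_B(k_B),$$ $$L_C(k)=\min_{\substack{k_A\in[0,n_A],\ k_B\in[0,n_B]\\ k_An_B+k_Bn_A-k_Ak_B=k}}\sigma_A(k_A)\,r_B+\sigma_B(k_B)\,r_A-\sigma_A(k_A)\,\sigma_B(k_B).$$ Suppose that $x\mapsto r_A-\sigma_A(n_A-x)$ and $x\mapsto r_B-\sigma_B(n_B-x)$ are log-log convex on $(0,n_A)$ and $(0,n_B)$, respectively. Then: 1. Both minima are attained for every $k\in[0,n_An_B]$. 2. $R_C(k)\le L_C(k)$ for every $k\in[d_Ad_B,\,n_An_B]$ with $R_C(k)\ge\max\{r_A,r_B\}$; more generally, $R_C(k)\le L_C(k)$ for every $k\in[\max\{n_Ad_B,\,d_An_B\},\,n_An_B]$. 3. $R_C$ is a rank expansion lower bound for $\mathbf C=\mathbf A\otimes\mathbf B$, when continued by the constant $R_C(n_An_B)$ beyond $n_An_B$. (So $R_C$ is continuous, nonnegative and increasing on $[0,n_An_B]$, and $R_C(k)\le\tilde\sigma_{\mathbf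 C}(k)$ for all $k\in\{1,\dots,n_An_B\}$.) 4. This bound is at least as tight as the bound without domain restriction: for all $k\in[0,n_An_B]$, $$\inf_{\substack{k_A\ge d_A,\ k_B\ge d_B\\ k_Ak_B\ge k}}\sigma_A(k_A)\,\sigma_B(k_B)\ \le\ R_C(k).$$ -/

import Mathlib

open Set
open scoped Kronecker

noncomputable section

/-- The matrix made of `k` different columns (those listed by `e`) of an identity matrix. -/
def selectionMatrix {n : Type*} [DecidableEq n] {k : ℕ} (e : Fin k ↪ n) : Matrix n (Fin k) ℂ :=
  (1 : Matrix n n ℂ).submatrix id e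

/-- The rank expansion of `A`: the smallest rank of `A * P` over all matrices `P` made of `k`
different columns of the identity. Meaningful for `k ≤ card n`, when such a `P` exists. -/
def rankExpansion {m n : Type*} [Fintype n] [DecidableEq n] (A : Matrix m n ℂ) (k : ℕ) : ℕ :=
  sInf {r : ℕ | ∃ e : Fin k ↪ n, r = (A * selectionMatrix e).rank}

/-- `σ` is a rank expansion lower bound for `A`: a continuous, nonnegative, increasing function on
`[0, ∞)` with `σ k` at most the rank expansion of `A` at `k`, for `k = 1, …, #columns`. -/
structure IsRankExpansionLowerBound {m n : Type*} [Fintype n] [DecidableEq n]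
    (A : Matrix m n ℂ) (σ : ℝ → ℝ) : Prop where
  continuousOn : ContinuousOn σ (Ici 0)
  nonneg : ∀ x ∈ Ici (0 : ℝ), 0 ≤ σ x
  monotoneOn : MonotoneOn σ (Ici 0)
  le_rankExpansion : ∀ k : ℕ, 1 ≤ k → k ≤ Fintype.card n → σ k ≤ (rankExpansion A k : ℝ)

/-- The pseudoinverse `f† x = sup {k ≥ 0 | f k ≤ x}` of an increasing function on `[0, ∞)`
(used where that set is bounded above). -/
def pseudoInv (f : ℝ → ℝ) (x : ℝ) : ℝ :=
  sSup {k : ℝ | 0 ≤ k ∧ f k ≤ x}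

/-- `f` is log-log convex on `s ⊆ (0, ∞)`: it is positive there, and `log f` is a convex function
of `log x`. -/
def LogLogConvexOn (s : Set ℝ) (f : ℝ → ℝ) : Prop :=
  (∀ x ∈ s, 0 < f x) ∧ ConvexOn ℝ (Real.exp ⁻¹' s) (fun u => Real.log (f (Real.exp u)))

/-- Values of the objective of the minimization defining `prevBound`. -/
def prevValues (σA σB : ℝ → ℝ) (k : ℝ) : Set ℝ :=
  {v | ∃ kA kB : ℝ, pseudoInv σA 1 ≤ kA ∧ pseudoInv σB 1 ≤ kB ∧ k ≤ kA * kB ∧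
    v = σA kA * σB kB}

/-- The bound `min {σA kA * σB kB | kA ≥ dA, kB ≥ dB, kA * kB ≥ k}`. -/
def prevBound (σA σB : ℝ → ℝ) (k : ℝ) : ℝ :=
  sInf (prevValues σA σB k)

/-- Values of the objective of the minimization defining `rectBound`. -/
def rectValues (σA σB : ℝ → ℝ) (nA nB : ℝ) (k : ℝ) : Set ℝ :=
  {v | ∃ kA ∈ Icc (pseudoInv σA 1) nA, ∃ kB ∈ Icc (pseudoInv σB 1) nB, k ≤ kA * kB ∧
    v = σA kA * σB kB}

/-- The domain-restricted rectangle bound `R_C`: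
`min {σA kA * σB kB | kA ∈ [dA, nA], kB ∈ [dB, nB], kA * kB ≥ k}`. -/
def rectBound (σA σB : ℝ → ℝ) (nA nB : ℝ) (k : ℝ) : ℝ :=
  sInf (rectValues σA σB nA nB k)

/-- Values of the objective of the minimization defining `lshapeBound`. -/
def lshapeValues (σA σB : ℝ → ℝ) (nA nB : ℝ) (k : ℝ) : Set ℝ :=
  {v | ∃ kA ∈ Icc 0 nA, ∃ kB ∈ Icc 0 nB, kA * nB + kB * nA - kA * kB = k ∧
    v = σA kA * σB nB + σB kB * σA nA - σA kA * σB kB}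

/-- The `L`-shaped bound `L_C`: with `rA = σA nA` and `rB = σB nB`,
`min {σA kA * rB + σB kB * rA - σA kA * σB kB | kA ∈ [0, nA], kB ∈ [0, nB],
kA * nB + kB * nA - kA * kB = k}`. -/
def lshapeBound (σA σB : ℝ → ℝ) (nA nB : ℝ) (k : ℝ) : ℝ :=
  sInf (lshapeValues σA σB nA nB k)

end

/-! A choice of `k` columns of `A ⊗ₖ B` is a set `S` of index pairs; let `s i` be the size of its
fiber over column `i` of `A`, and `X y` the number of `i` with `y < s i`. The superlevel sets of `s`
form a flag, so a greedy choice (`exists_linearIndepOn_flag`) gives independent columns `I` of `A`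
of which at least `σA (X y)` satisfy `y < s i`, for every `y`. By `sum_finrank_le_finrank_kronecker`
the rank on `S` is at least the sum over `I` of `max 1 (σB (s i))`. It remains to bound this sum
below by `R_C k`, a purely real inequality.

If `k ≤ dA * nB`, Jensen's inequality for `σB` compares `s` with an average of rectangles of area
`k` (`rectBound_le_sum_of_le`); `k ≤ nA * dB` follows by swapping the factors. For larger `k`, `s`
is an average of two-step shapes of area `k` (`rectBound_le_sum_of_ge`). With the height of the step
fixed, the value of such a shape is concave along a segment whose ends are rectangles or L-shapes
(`rectBound_le_two_step`).

For L-shapes, `rA * rB` minus the value is `(rA - σA x) * (rB - σB y)`, and the complementary sides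
have the fixed product `nA * nB - k`. Log-log convexity makes this product largest at the ends of
the hyperbola, where the L-shape is a rectangle spanning the box (`min_le_lshape`). This also gives
`R_C ≤ L_C`. -/

/-- The analytic hypotheses on a rank expansion lower bound: it is concave, vanishes at `0`, and
exceeds `1` past a finite threshold, which is at most `n`. -/
structure IsProfile (u : ℝ → ℝ) (n : ℝ) : Prop where
  continuousOn : ContinuousOn u (Ici 0)
  monotoneOn : MonotoneOn u (Ici 0)
  concaveOn : ConcaveOn ℝ (Ici 0) u
  map_zero : u 0 = 0
  bddAbove : BddAbove {k : ℝ | 0 ≤ k ∧ u k ≤ 1}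
  pseudoInv_le : pseudoInv u 1 ≤ n

/-! ### Concave profiles and the threshold where they reach 1. -/

namespace IsProfile

variable {u : ℝ → ℝ} {n : ℝ}

lemma mono (h : IsProfile u n) {x y : ℝ} (hx : 0 ≤ x) (hxy : x ≤ y) : u x ≤ u y :=
  h.monotoneOn hx (hx.trans hxy) hxy

lemma nonneg (h : IsProfile u n) {x : ℝ} (hx : 0 ≤ x) : 0 ≤ u x :=
  h.map_zero ▸ h.mono le_rfl hx

lemma pseudoInv_nonneg (h : IsProfile u n) : 0 ≤ pseudoInv u 1 :=
  le_csSup h.bddAbove ⟨le_rfl, by rw [h.map_zero]; exact zero_le_one⟩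

lemma one_lt_of_pseudoInv_lt (h : IsProfile u n) {x : ℝ} (hx : pseudoInv u 1 < x) : 1 < u x := by
  by_contra! hle
  exact hx.not_ge (le_csSup h.bddAbove ⟨h.pseudoInv_nonneg.trans hx.le, hle⟩)

/-- Continuity is what makes the threshold value exact: the value 1 is attained at or before the
supremum, and the closed sublevel set contains its supremum. -/
lemma map_pseudoInv (h : IsProfile u n) : u (pseudoInv u 1) = 1 := by
  have hlt := h.one_lt_of_pseudoInv_lt (lt_add_one (pseudoInv u 1))
  have h0 := h.pseudoInv_nonneg
  have hsub : Icc 0 (pseudoInv u 1 + 1) ⊆ Ici 0 := Icc_subset_Ici_self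
  obtain ⟨c, hc, hc1⟩ := intermediate_value_Icc (by linarith : (0 : ℝ) ≤ pseudoInv u 1 + 1)
    (h.continuousOn.mono hsub) ⟨by rw [h.map_zero]; exact zero_le_one, hlt.le⟩
  have hcle : c ≤ pseudoInv u 1 := le_csSup h.bddAbove ⟨hc.1, hc1.le⟩
  rcases hcle.eq_or_lt with rfl | hcl
  · exact hc1
  refine le_antisymm ?_ (hc1.symm.trans_le (h.mono hc.1 hcle))
  by_contra! hgt
  have hclosed : IsClosed {k : ℝ | 0 ≤ k ∧ u k ≤ 1} :=
    h.continuousOn.preimage_isClosed_of_isClosed isClosed_Ici isClosed_Iic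
  exact hgt.not_ge (hclosed.csSup_mem ⟨c, hc.1, hc1.le⟩ h.bddAbove).2

lemma pseudoInv_pos (h : IsProfile u n) : 0 < pseudoInv u 1 := by
  refine h.pseudoInv_nonneg.lt_of_ne fun h0 => ?_
  have := h.map_pseudoInv
  rw [← h0, h.map_zero] at this
  exact zero_ne_one this

lemma one_le (h : IsProfile u n) {x : ℝ} (hx : pseudoInv u 1 ≤ x) : 1 ≤ u x :=
  h.map_pseudoInv ▸ h.mono h.pseudoInv_nonneg hx

lemma pos (h : IsProfile u n) : 0 < n := h.pseudoInv_pos.trans_le h.pseudoInv_le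

lemma mul_le_map_mul (h : IsProfile u n) {x t : ℝ} (hx : 0 ≤ x) (ht : 0 ≤ t) (ht1 : t ≤ 1) :
    t * u x ≤ u (t * x) := by
  have := h.concaveOn.2 (mem_Ici.2 hx) (mem_Ici.2 le_rfl) ht (sub_nonneg.2 ht1)
    (add_sub_cancel t 1)
  simpa [h.map_zero] using this

lemma map_pos (h : IsProfile u n) {x : ℝ} (hx : 0 < x) : 0 < u x := by
  rcases le_or_gt (pseudoInv u 1) x with hd | hd
  · exact zero_lt_one.trans_le (h.one_le hd)
  -- Below the threshold, concavity keeps `u` above the chord from the origin.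
  · have hd0 := h.pseudoInv_pos
    have := h.mul_le_map_mul hd0.le (div_nonneg hx.le hd0.le) ((div_le_one hd0).2 hd.le)
    rw [h.map_pseudoInv, mul_one, div_mul_cancel₀ _ hd0.ne'] at this
    exact (div_pos hx hd0).trans_le this

end IsProfile

/-! ### Attainment, monotonicity and continuity of the bounds. -/

section Bounds

variable {u v : ℝ → ℝ} {n m k : ℝ}

lemma rectValues_eq_image (u v : ℝ → ℝ) (n m k : ℝ) :
    rectValues u v n m k = (fun p : ℝ × ℝ => u p.1 * v p.2) ''
      ((Icc (pseudoInv u 1) n ×ˢ Icc (pseudoInv v 1) m) ∩ {p | k ≤ p.1 * p.2}) := by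
  ext w
  constructor
  · rintro ⟨x, hx, y, hy, hk, rfl⟩
    exact ⟨(x, y), ⟨⟨hx, hy⟩, hk⟩, rfl⟩
  · rintro ⟨⟨x, y⟩, ⟨⟨hx, hy⟩, hk⟩, rfl⟩
    exact ⟨x, hx, y, hy, hk, rfl⟩

lemma isLeast_rectBound (hu : IsProfile u n) (hv : IsProfile v m) (hk : k ≤ n * m) :
    IsLeast (rectValues u v n m k) (rectBound u v n m k) := by
  refine IsCompact.isLeast_sInf ?_
    ⟨_, n, ⟨hu.pseudoInv_le, le_rfl⟩, m, ⟨hv.pseudoInv_le, le_rfl⟩, hk, rfl⟩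
  rw [rectValues_eq_image]
  refine IsCompact.image_of_continuousOn ?_ ?_
  · exact (isCompact_Icc.prod isCompact_Icc).inter_right
      (isClosed_le continuous_const (continuous_fst.mul continuous_snd))
  · refine ContinuousOn.mul (hu.continuousOn.comp continuousOn_fst ?_)
      (hv.continuousOn.comp continuousOn_snd ?_)
    · exact fun p hp => hu.pseudoInv_nonneg.trans hp.1.1.1
    · exact fun p hp => hv.pseudoInv_nonneg.trans hp.1.2.1

lemma lshapeValues_eq_image (u v : ℝ → ℝ) (n m k : ℝ) :
    lshapeValues u v n m k = (fun p : ℝ × ℝ => u p.1 * v m + v p.2 * u n - u p.1 * v p.2) ''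
      ((Icc 0 n ×ˢ Icc 0 m) ∩ {p | p.1 * m + p.2 * n - p.1 * p.2 = k}) := by
  ext w
  constructor
  · rintro ⟨x, hx, y, hy, hk, rfl⟩
    exact ⟨(x, y), ⟨⟨hx, hy⟩, hk⟩, rfl⟩
  · rintro ⟨⟨x, y⟩, ⟨⟨hx, hy⟩, hk⟩, rfl⟩
    exact ⟨x, hx, y, hy, hk, rfl⟩

lemma isLeast_lshapeBound (hu : IsProfile u n) (hv : IsProfile v m) (hk : k ∈ Icc 0 (n * m)) :
    IsLeast (lshapeValues u v n m k) (lshapeBound u v n m k) := by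
  have hm := hv.pos
  have hn := hu.pos
  refine IsCompact.isLeast_sInf ?_
    ⟨_, k / m, ⟨div_nonneg hk.1 hm.le, (div_le_iff₀ hm).2 hk.2⟩, 0, ⟨le_rfl, hm.le⟩, ?_, rfl⟩
  · rw [lshapeValues_eq_image]
    refine IsCompact.image_of_continuousOn ?_ ?_
    · exact (isCompact_Icc.prod isCompact_Icc).inter_right
        (isClosed_eq (by fun_prop) continuous_const)
    · have h1 : ContinuousOn (fun p : ℝ × ℝ => u p.1)
          ((Icc 0 n ×ˢ Icc 0 m) ∩ {p | p.1 * m + p.2 * n - p.1 * p.2 = k}) :=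
        hu.continuousOn.comp continuousOn_fst fun p hp => hp.1.1.1
      have h2 : ContinuousOn (fun p : ℝ × ℝ => v p.2)
          ((Icc 0 n ×ˢ Icc 0 m) ∩ {p | p.1 * m + p.2 * n - p.1 * p.2 = k}) :=
        hv.continuousOn.comp continuousOn_snd fun p hp => hp.1.2.1
      exact ((h1.mul continuousOn_const).add (h2.mul continuousOn_const)).sub (h1.mul h2)
  · field_simp; ring

lemma bddBelow_prevValues (hu : IsProfile u n) (hv : IsProfile v m) (k : ℝ) :
    BddBelow (prevValues u v k) := by
  refine ⟨0, ?_⟩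
  rintro _ ⟨x, y, hx, hy, -, rfl⟩
  exact mul_nonneg (hu.nonneg (hu.pseudoInv_nonneg.trans hx))
    (hv.nonneg (hv.pseudoInv_nonneg.trans hy))

lemma rectValues_subset_prevValues (u v : ℝ → ℝ) (n m k : ℝ) :
    rectValues u v n m k ⊆ prevValues u v k := by
  rintro _ ⟨x, hx, y, hy, hk, rfl⟩
  exact ⟨x, y, hx.1, hy.1, hk, rfl⟩

lemma bddBelow_rectValues (hu : IsProfile u n) (hv : IsProfile v m) (k : ℝ) :
    BddBelow (rectValues u v n m k) :=
  (bddBelow_prevValues hu hv k).mono (rectValues_subset_prevValues u v n m k)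

lemma rectBound_le (hu : IsProfile u n) (hv : IsProfile v m) {x y : ℝ}
    (hx : x ∈ Icc (pseudoInv u 1) n) (hy : y ∈ Icc (pseudoInv v 1) m) (hk : k ≤ x * y) :
    rectBound u v n m k ≤ u x * v y :=
  csInf_le (bddBelow_rectValues hu hv k) ⟨x, hx, y, hy, hk, rfl⟩

lemma prevBound_le_rectBound (hu : IsProfile u n) (hv : IsProfile v m) (hk : k ≤ n * m) :
    prevBound u v k ≤ rectBound u v n m k :=
  csInf_le_csInf (bddBelow_prevValues hu hv k) (isLeast_rectBound hu hv hk).nonempty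
    (rectValues_subset_prevValues u v n m k)

lemma rectBound_nonneg (hu : IsProfile u n) (hv : IsProfile v m) (hk : k ≤ n * m) :
    0 ≤ rectBound u v n m k := by
  obtain ⟨x, hx, y, hy, -, he⟩ := (isLeast_rectBound hu hv hk).1
  rw [he]
  exact mul_nonneg (hu.nonneg (hu.pseudoInv_nonneg.trans hx.1))
    (hv.nonneg (hv.pseudoInv_nonneg.trans hy.1))

lemma rectBound_mono (hu : IsProfile u n) (hv : IsProfile v m) {l : ℝ} (hkl : k ≤ l)
    (hl : l ≤ n * m) : rectBound u v n m k ≤ rectBound u v n m l := by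
  refine csInf_le_csInf (bddBelow_rectValues hu hv k) (isLeast_rectBound hu hv hl).nonempty ?_
  rintro _ ⟨x, hx, y, hy, hk, rfl⟩
  exact ⟨x, hx, y, hy, hkl.trans hk, rfl⟩

lemma rectBound_comm (u v : ℝ → ℝ) (n m k : ℝ) :
    rectBound u v n m k = rectBound v u m n k := by
  unfold rectBound
  congr 1
  ext w
  constructor <;>
  · rintro ⟨x, hx, y, hy, hk, rfl⟩
    exact ⟨y, hy, x, hx, by rwa [mul_comm], mul_comm _ _⟩

lemma rectBound_le_one (hu : IsProfile u n) (hv : IsProfile v m)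
    (hk : k ≤ pseudoInv u 1 * pseudoInv v 1) : rectBound u v n m k ≤ 1 := by
  have := rectBound_le hu hv ⟨le_rfl, hu.pseudoInv_le⟩ ⟨le_rfl, hv.pseudoInv_le⟩ hk
  rwa [hu.map_pseudoInv, hv.map_pseudoInv, one_mul] at this

/-- Above `n * dv`, every rectangle of area `k` in the box is admissible. -/
lemma rectBound_le_of_mul_eq (hu : IsProfile u n) (hv : IsProfile v m) {x y : ℝ}
    (hk : max (n * pseudoInv v 1) (pseudoInv u 1 * m) ≤ k)
    (hx : x ∈ Icc 0 n) (hy : y ∈ Icc 0 m) (hxy : x * y = k) :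
    rectBound u v n m k ≤ u x * v y := by
  have hn := hu.pos
  have hm := hv.pos
  obtain ⟨h1, h2⟩ := max_le_iff.1 hk
  refine rectBound_le hu hv ⟨?_, hx.2⟩ ⟨?_, hy.2⟩ hxy.ge
  · refine le_of_mul_le_mul_right (h2.trans ?_) hm
    rw [← hxy]
    exact mul_le_mul_of_nonneg_left hy.2 hx.1
  · refine le_of_mul_le_mul_left (h1.trans ?_) hn
    rw [← hxy]
    exact mul_le_mul_of_nonneg_right hx.2 hy.1

/-- Parametrization of `rectBound` by the first side of the rectangle. -/
lemma rectBound_eq_sInf_image (hu : IsProfile u n) (hv : IsProfile v m)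
    (hk : k ∈ Icc 0 (n * m)) :
    rectBound u v n m k = sInf ((fun x => u (max x (k / m)) *
      v (max (pseudoInv v 1) (k / max x (k / m)))) '' Icc (pseudoInv u 1) n) := by
  have hm := hv.pos
  have hdu := hu.pseudoInv_pos
  have hdv := hv.pseudoInv_pos
  have hkm : 0 ≤ k / m := div_nonneg hk.1 hm.le
  refine le_antisymm (le_csInf ⟨_, n, ⟨hu.pseudoInv_le, le_rfl⟩, rfl⟩ ?_) ?_
  · rintro _ ⟨x, hx, rfl⟩
    have hpos : 0 < max x (k / m) := lt_max_of_lt_left (hdu.trans_le hx.1)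
    refine rectBound_le hu hv ⟨le_max_of_le_left hx.1, max_le hx.2 ((div_le_iff₀ hm).2 hk.2)⟩
      ⟨le_max_left _ _, max_le hv.pseudoInv_le ?_⟩ ?_
    · rw [div_le_iff₀ hpos, mul_comm, ← div_le_iff₀ hm]
      exact le_max_right _ _
    · rw [mul_comm, ← div_le_iff₀ hpos]
      exact le_max_right _ _
  · obtain ⟨x, hx, y, hy, hxy, he⟩ := (isLeast_rectBound hu hv hk.2).1
    have hx0 : 0 < x := hdu.trans_le hx.1
    have hkx : k / m ≤ x := (div_le_iff₀ hm).2
      (hxy.trans (mul_le_mul_of_nonneg_left hy.2 hx0.le))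
    refine (csInf_le ⟨0, ?_⟩ (mem_image_of_mem _ hx)).trans ?_
    · rintro _ ⟨z, hz, rfl⟩
      exact mul_nonneg (hu.nonneg (le_max_of_le_right hkm))
        (hv.nonneg (le_max_of_le_left hdv.le))
    · rw [max_eq_left hkx, he]
      refine mul_le_mul_of_nonneg_left (hv.mono (le_max_of_le_left hdv.le) (max_le hy.1 ?_))
        (hu.nonneg hx0.le)
      rwa [div_le_iff₀ hx0, mul_comm]

/-- Clipping the sides turns the minimum into one over a fixed compact interval, with `k` only in
the objective; the infimum of a jointly continuous function over a compact set is continuous. -/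
lemma continuousOn_rectBound (hu : IsProfile u n) (hv : IsProfile v m) :
    ContinuousOn (fun k => rectBound u v n m (min k (n * m))) (Ici 0) := by
  have hm := hv.pos
  have hn := hu.pos
  have hdu := hu.pseudoInv_pos
  have hdv := hv.pseudoInv_pos
  -- The extra truncations change nothing on the relevant range; they keep the arguments nonnegative
  -- and the denominator positive, so that the objective is continuous on the whole plane.
  set c : ℝ → ℝ := fun k => max 0 (min k (n * m)) with hc
  have hcc : Continuous c := by fun_prop
  set g : ℝ → ℝ → ℝ := fun k x => max (max x (pseudoInv u 1)) (c k / m) with hg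
  have hgc : Continuous fun p : ℝ × ℝ => g p.1 p.2 := by simp only [hg]; fun_prop
  have hgpos : ∀ k x, 0 < g k x := fun k x => lt_max_of_lt_left (lt_max_of_lt_right hdu)
  set f : ℝ → ℝ → ℝ := fun k x => u (g k x) * v (max (pseudoInv v 1) (c k / g k x)) with hf
  have hfc : Continuous fun p : ℝ × ℝ => f p.1 p.2 := by
    refine Continuous.mul ?_ ?_
    · exact hu.continuousOn.comp_continuous hgc fun p => (hgpos p.1 p.2).le
    · refine hv.continuousOn.comp_continuous (continuous_const.max ?_)
        fun p => le_max_of_le_left hdv.le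
      exact (hcc.comp continuous_fst).div hgc fun p => (hgpos p.1 p.2).ne'
  have hcont := (isCompact_Icc (a := pseudoInv u 1) (b := n)).continuous_sInf (f := f) hfc
  refine hcont.continuousOn.congr fun k hk => ?_
  have hmem : min k (n * m) ∈ Icc 0 (n * m) :=
    ⟨le_min hk (mul_nonneg hn.le hm.le), min_le_right _ _⟩
  have hck : c k = min k (n * m) := max_eq_right hmem.1
  dsimp only
  rw [rectBound_eq_sInf_image hu hv hmem]
  congr 1
  refine image_congr fun x hx => ?_
  simp only [hf, hg, hck, max_eq_left hx.1]

end Bounds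

/-! ### Products of log-log convex functions along a hyperbola. -/

section LogLogConvex

variable {f g : ℝ → ℝ} {n m : ℝ}

/-- The product of two log-log convex functions is quasiconvex along a hyperbola. -/
lemma LogLogConvexOn.mul_le_max (hf : LogLogConvexOn (Ioo 0 n) f)
    (hg : LogLogConvexOn (Ioo 0 m) g) {c x₁ x x₂ : ℝ} (hc : 0 < c) (hx₁ : c / m < x₁)
    (hm : 0 < m) (h₁ : x₁ ≤ x) (h₂ : x ≤ x₂) (hx₂ : x₂ < n) :
    f x * g (c / x) ≤ max (f x₁ * g (c / x₁)) (f x₂ * g (c / x₂)) := by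
  have hcm : 0 < c / m := div_pos hc hm
  have hI : ∀ z, x₁ ≤ z → z ≤ x₂ → z ∈ Ioo 0 n ∧ c / z ∈ Ioo 0 m := fun z hz1 hz2 => by
    have hz0 : 0 < z := hcm.trans (hx₁.trans_le hz1)
    refine ⟨⟨hz0, hz2.trans_lt hx₂⟩, div_pos hc hz0, ?_⟩
    rw [div_lt_iff₀ hz0, mul_comm, ← div_lt_iff₀ hm]
    exact hx₁.trans_le hz1
  have hx₁0 : 0 < x₁ := hcm.trans hx₁
  have hx0 : 0 < x := hx₁0.trans_le h₁
  have hx₂0 : 0 < x₂ := hx0.trans_le h₂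
  have hseg : Real.log x ∈ segment ℝ (Real.log x₁) (Real.log x₂) := by
    rw [segment_eq_Icc (Real.log_le_log hx₁0 (h₁.trans h₂))]
    exact ⟨Real.log_le_log hx₁0 h₁, Real.log_le_log hx0 h₂⟩
  obtain ⟨a, b, ha, hb, hab, he⟩ := hseg
  have hpos : ∀ z, x₁ ≤ z → z ≤ x₂ → 0 < f z * g (c / z) := fun z hz1 hz2 =>
    mul_pos (hf.1 _ (hI z hz1 hz2).1) (hg.1 _ (hI z hz1 hz2).2)
  have i₁ := hI x₁ le_rfl (h₁.trans h₂)
  have i₂ := hI x₂ (h₁.trans h₂) le_rfl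
  have i := hI x h₁ h₂
  have key : Real.log (f x * g (c / x)) ≤
      a * Real.log (f x₁ * g (c / x₁)) + b * Real.log (f x₂ * g (c / x₂)) := by
    have mf : ∀ z ∈ Ioo 0 n, Real.log z ∈ Real.exp ⁻¹' Ioo 0 n := fun z hz => by
      rwa [mem_preimage, Real.exp_log hz.1]
    have mg : ∀ z ∈ Ioo 0 m, Real.log z ∈ Real.exp ⁻¹' Ioo 0 m := fun z hz => by
      rwa [mem_preimage, Real.exp_log hz.1]
    have kf := hf.2.2 (mf _ i₁.1) (mf _ i₂.1) ha hb hab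
    have kg := hg.2.2 (mg _ i₁.2) (mg _ i₂.2) ha hb hab
    -- `log (c / z)` is affine in `log z`, so one pair of weights serves both factors.
    have he' : a • Real.log (c / x₁) + b • Real.log (c / x₂) = Real.log (c / x) := by
      rw [Real.log_div hc.ne' hx₁0.ne', Real.log_div hc.ne' hx₂0.ne',
        Real.log_div hc.ne' hx0.ne', ← he]
      simp only [smul_eq_mul]
      linear_combination (Real.log c) * hab
    rw [he] at kf
    rw [he'] at kg
    simp only [Real.exp_log hx0, Real.exp_log hx₁0, Real.exp_log hx₂0, Real.exp_log i₁.2.1,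
      Real.exp_log i₂.2.1, Real.exp_log i.2.1, smul_eq_mul] at kf kg
    rw [Real.log_mul (hf.1 _ i.1).ne' (hg.1 _ i.2).ne',
      Real.log_mul (hf.1 _ i₁.1).ne' (hg.1 _ i₁.2).ne',
      Real.log_mul (hf.1 _ i₂.1).ne' (hg.1 _ i₂.2).ne']
    linarith
  set M := max (f x₁ * g (c / x₁)) (f x₂ * g (c / x₂))
  have hM : 0 < M := lt_max_of_lt_left (hpos x₁ le_rfl (h₁.trans h₂))
  rw [← Real.log_le_log_iff (hpos x h₁ h₂) hM]
  refine key.trans ?_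
  have l₁ : Real.log (f x₁ * g (c / x₁)) ≤ Real.log M :=
    Real.log_le_log (hpos x₁ le_rfl (h₁.trans h₂)) (le_max_left _ _)
  have l₂ : Real.log (f x₂ * g (c / x₂)) ≤ Real.log M :=
    Real.log_le_log (hpos x₂ (h₁.trans h₂) le_rfl) (le_max_right _ _)
  calc _ ≤ a * Real.log M + b * Real.log M := by gcongr
    _ = Real.log M := by rw [← add_mul, hab, one_mul]

/-- The version of `LogLogConvexOn.mul_le_max` at the ends of the hyperbola. -/
lemma LogLogConvexOn.mul_le_max_of_continuousOn (hf : LogLogConvexOn (Ioo 0 n) f)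
    (hg : LogLogConvexOn (Ioo 0 m) g) (hfc : ContinuousOn f (Icc 0 n))
    (hgc : ContinuousOn g (Icc 0 m)) {x y : ℝ} (hx : x ∈ Ioo 0 n) (hy : y ∈ Ioo 0 m) :
    f x * g y ≤ max (f (x * y / m) * g m) (f n * g (x * y / n)) := by
  have hm : 0 < m := hy.1.trans hy.2
  have hn : 0 < n := hx.1.trans hx.2
  have hc : 0 < x * y := mul_pos hx.1 hy.1
  set c := x * y
  have hcm : 0 < c / m := div_pos hc hm
  have hcx : c / m < x := (div_lt_iff₀ hm).2 (mul_lt_mul_of_pos_left hy.2 hx.1)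
  have hcy : c / x = y := mul_div_cancel_left₀ y hx.1.ne'
  set φ : ℝ → ℝ := fun z => f z * g (c / z) with hφ
  have hφc : ContinuousOn φ (Icc (c / m) n) := by
    refine (hfc.mono (Icc_subset_Icc_left hcm.le)).mul (hgc.comp ?_ ?_)
    · exact continuousOn_const.div continuousOn_id fun z hz => (hcm.trans_le hz.1).ne'
    · intro z hz
      have hz0 : 0 < z := hcm.trans_le hz.1
      refine ⟨(div_pos hc hz0).le, ?_⟩
      rw [div_le_iff₀ hz0, mul_comm, ← div_le_iff₀ hm]
      exact hz.1
  have hlt : c / m < n := hcx.trans hx.2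
  -- Convexity is known only on the open intervals; the ends are reached by letting `x₁` decrease to
  -- `c / m`, then `x₂` increase to `n`.
  have t₁ : Filter.Tendsto φ (nhdsWithin (c / m) (Ioi (c / m))) (nhds (φ (c / m))) :=
    ((hφc _ ⟨le_rfl, hlt.le⟩).mono_of_mem_nhdsWithin (Icc_mem_nhdsGT hlt))
  have t₂ : Filter.Tendsto φ (nhdsWithin n (Iio n)) (nhds (φ n)) :=
    ((hφc _ ⟨hlt.le, le_rfl⟩).mono_of_mem_nhdsWithin (Icc_mem_nhdsLT hlt))
  have step : ∀ x₂ ∈ Ico x n, φ x ≤ max (φ (c / m)) (φ x₂) := fun x₂ hx₂ => by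
    refine ge_of_tendsto (t₁.max tendsto_const_nhds) ?_
    filter_upwards [Ioc_mem_nhdsGT hcx] with x₁ hx₁
    exact hf.mul_le_max hg hc hx₁.1 hm hx₁.2 hx₂.1 hx₂.2
  have fin : φ x ≤ max (φ (c / m)) (φ n) := by
    refine ge_of_tendsto (tendsto_const_nhds.max t₂) ?_
    filter_upwards [Ico_mem_nhdsLT hx.2] with x₂ hx₂
    exact step x₂ hx₂
  simpa only [hφ, hcy, div_div_cancel₀ hc.ne'] using fin

end LogLogConvex

/-! ### L-shapes and two-step shapes compared with rectangles. -/

section LShape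

variable {u v : ℝ → ℝ} {n m k : ℝ}

/-- The deficit from `u n * v m` factors as `(u n - u x) * (v m - v y)`, with `(n - x) * (m - y) = n
* m - k`. Maximizing it along this hyperbola leads to the two rectangles that span the box in one
direction. -/
lemma min_le_lshape (hu : IsProfile u n) (hv : IsProfile v m)
    (hul : LogLogConvexOn (Ioo 0 n) (fun x => u n - u (n - x)))
    (hvl : LogLogConvexOn (Ioo 0 m) (fun x => v m - v (m - x))) {x y : ℝ}
    (hx : x ∈ Icc 0 n) (hy : y ∈ Icc 0 m) (hk : x * m + y * n - x * y = k) :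
    min (u (k / m) * v m) (u n * v (k / n)) ≤ u x * v m + v y * u n - u x * v y := by
  have hn := hu.pos
  have hm := hv.pos
  -- The hyperbola argument needs an interior point. On the boundary the L-shape is already a
  -- rectangle: the whole box here, a spanning one when `x` or `y` is 0.
  have hfull : x = n ∨ y = m → min (u (k / m) * v m) (u n * v (k / n)) ≤
      u x * v m + v y * u n - u x * v y := by
    intro h
    have hkn : k / m = n := by
      rw [div_eq_iff hm.ne', ← hk]
      rcases h with rfl | rfl <;> ring
    refine (min_le_left _ _).trans_eq ?_
    rw [hkn]
    rcases h with rfl | rfl <;> ring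
  rcases hx.1.eq_or_lt with rfl | hx0
  · have : k / n = y := by rw [div_eq_iff hn.ne', ← hk]; ring
    refine (min_le_right _ _).trans_eq ?_
    rw [this, hu.map_zero]; ring
  rcases hy.1.eq_or_lt with rfl | hy0
  · have : k / m = x := by rw [div_eq_iff hm.ne', ← hk]; ring
    refine (min_le_left _ _).trans_eq ?_
    rw [this, hv.map_zero]; ring
  rcases hx.2.eq_or_lt with rfl | hxn
  · exact hfull (Or.inl rfl)
  rcases hy.2.eq_or_lt with rfl | hym
  · exact hfull (Or.inr rfl)
  have cu : ContinuousOn (fun x => u n - u (n - x)) (Icc 0 n) :=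
    continuousOn_const.sub (hu.continuousOn.comp (by fun_prop) fun z hz => sub_nonneg.2 hz.2)
  have cv : ContinuousOn (fun x => v m - v (m - x)) (Icc 0 m) :=
    continuousOn_const.sub (hv.continuousOn.comp (by fun_prop) fun z hz => sub_nonneg.2 hz.2)
  have key := hul.mul_le_max_of_continuousOn hvl cu cv (x := n - x) (y := m - y)
    ⟨by linarith, by linarith⟩ ⟨by linarith, by linarith⟩
  have e₁ : n - (n - x) * (m - y) / m = k / m := by rw [← hk]; field_simp; ring
  have e₂ : m - (n - x) * (m - y) / n = k / n := by rw [← hk]; field_simp; ring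
  simp only [sub_sub_cancel, sub_self, hu.map_zero, hv.map_zero, sub_zero, e₁, e₂] at key
  rcases le_max_iff.1 key with h | h
  · exact (min_le_left _ _).trans (by nlinarith)
  · exact (min_le_right _ _).trans (by nlinarith)

lemma min_le_lshapeBound (hu : IsProfile u n) (hv : IsProfile v m)
    (hul : LogLogConvexOn (Ioo 0 n) (fun x => u n - u (n - x)))
    (hvl : LogLogConvexOn (Ioo 0 m) (fun x => v m - v (m - x))) (hk : k ∈ Icc 0 (n * m)) :
    min (u (k / m) * v m) (u n * v (k / n)) ≤ lshapeBound u v n m k := by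
  obtain ⟨x, hx, y, hy, hxy, he⟩ := (isLeast_lshapeBound hu hv hk).1
  rw [he]
  exact min_le_lshape hu hv hul hvl hx hy hxy

lemma rectBound_le_min (hu : IsProfile u n) (hv : IsProfile v m)
    (hk : k ∈ Icc (max (n * pseudoInv v 1) (pseudoInv u 1 * m)) (n * m)) :
    rectBound u v n m k ≤ min (u (k / m) * v m) (u n * v (k / n)) := by
  have hn := hu.pos
  have hm := hv.pos
  have hk0 : 0 ≤ k := (mul_nonneg hn.le hv.pseudoInv_nonneg).trans ((le_max_left _ _).trans hk.1)
  refine le_min ?_ ?_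
  · exact rectBound_le_of_mul_eq hu hv hk.1 ⟨by positivity, (div_le_iff₀ hm).2 hk.2⟩
      ⟨hm.le, le_rfl⟩ (div_mul_cancel₀ _ hm.ne')
  · exact rectBound_le_of_mul_eq hu hv hk.1 ⟨hn.le, le_rfl⟩
      ⟨by positivity, (div_le_iff₀' hn).2 hk.2⟩ (mul_div_cancel₀ _ hn.ne')

lemma rectBound_le_lshape (hu : IsProfile u n) (hv : IsProfile v m)
    (hul : LogLogConvexOn (Ioo 0 n) (fun x => u n - u (n - x)))
    (hvl : LogLogConvexOn (Ioo 0 m) (fun x => v m - v (m - x)))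
    (hk : k ∈ Icc (max (n * pseudoInv v 1) (pseudoInv u 1 * m)) (n * m)) {x y : ℝ}
    (hx : x ∈ Icc 0 n) (hy : y ∈ Icc 0 m) (hxy : x * m + y * n - x * y = k) :
    rectBound u v n m k ≤ u x * v m + v y * u n - u x * v y :=
  (rectBound_le_min hu hv hk).trans (min_le_lshape hu hv hul hvl hx hy hxy)

lemma rectBound_le_lshapeBound (hu : IsProfile u n) (hv : IsProfile v m)
    (hul : LogLogConvexOn (Ioo 0 n) (fun x => u n - u (n - x)))
    (hvl : LogLogConvexOn (Ioo 0 m) (fun x => v m - v (m - x)))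
    (hk : k ∈ Icc (max (n * pseudoInv v 1) (pseudoInv u 1 * m)) (n * m)) :
    rectBound u v n m k ≤ lshapeBound u v n m k := by
  have hk0 : 0 ≤ k :=
    (mul_nonneg hu.pos.le hv.pseudoInv_nonneg).trans ((le_max_left _ _).trans hk.1)
  exact (rectBound_le_min hu hv hk).trans (min_le_lshapeBound hu hv hul hvl ⟨hk0, hk.2⟩)

/-- A rectangle bound of at least `u n` forces `k` to be at least `n * dv`. -/
lemma mul_pseudoInv_le_of_le_rectBound (hu : IsProfile u n) (hv : IsProfile v m)
    (hul : LogLogConvexOn (Ioo 0 n) (fun x => u n - u (n - x)))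
    (hk : pseudoInv u 1 * pseudoInv v 1 ≤ k) (h : u n ≤ rectBound u v n m k) :
    n * pseudoInv v 1 ≤ k := by
  by_contra! hlt
  have hdv := hv.pseudoInv_pos
  have hdk : pseudoInv u 1 ≤ k / pseudoInv v 1 := (le_div_iff₀ hdv).2 hk
  have hkn : k / pseudoInv v 1 < n := (div_lt_iff₀ hdv).2 hlt
  have hle := rectBound_le (k := k) hu hv ⟨hdk, hkn.le⟩ ⟨le_rfl, hv.pseudoInv_le⟩
    (div_mul_cancel₀ _ hdv.ne').ge
  rw [hv.map_pseudoInv, mul_one] at hle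
  -- Positivity of the log-log convex function makes `u` strictly smaller than `u n` at this side.
  have hpos := hul.1 (n - k / pseudoInv v 1)
    ⟨by linarith, by linarith [hu.pseudoInv_pos]⟩
  simp only [sub_sub_cancel] at hpos
  linarith

/-- A two-step shape: `x₁` columns of full height `m` and `x₂ - x₁` columns of height `y`. -/
lemma rectBound_le_two_step (hu : IsProfile u n) (hv : IsProfile v m)
    (hul : LogLogConvexOn (Ioo 0 n) (fun x => u n - u (n - x)))
    (hvl : LogLogConvexOn (Ioo 0 m) (fun x => v m - v (m - x)))
    (hk : k ∈ Icc (max (n * pseudoInv v 1) (pseudoInv u 1 * m)) (n * m)) {x₁ x₂ y : ℝ}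
    (h₁ : 0 ≤ x₁) (h₁₂ : x₁ ≤ x₂) (h₂ : x₂ ≤ n) (hy : y ∈ Icc 0 m)
    (hxy : m * x₁ + y * (x₂ - x₁) = k) :
    rectBound u v n m k ≤ u x₁ * v m + (u x₂ - u x₁) * v y := by
  have hn := hu.pos
  have hm := hv.pos
  have hk0 : 0 < k := (mul_pos hn hv.pseudoInv_pos).trans_le ((le_max_left _ _).trans hk.1)
  have hxb : k / m ∈ Icc 0 n := ⟨by positivity, (div_le_iff₀ hm).2 hk.2⟩
  have hfull : rectBound u v n m k ≤ u (k / m) * v m :=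
    (rectBound_le_min hu hv hk).trans (min_le_left _ _)
  have hvy : 0 ≤ v y := hv.nonneg hy.1
  have hvm : v y ≤ v m := hv.mono hy.1 hy.2
  -- For fixed `y`, the area constraint is a line in `(x₁, x₂)` and the value is concave there, its
  -- coefficients `v m - v y` and `v y` being nonnegative. Hence the bound at `(a, b)` and at `(k /
  -- m, k / m)` gives it in between.
  have conc : ∀ a b, 0 ≤ a → a ≤ x₁ → x₁ ≤ k / m → 0 ≤ b → m * a + y * (b - a) = k → 0 < y →
      rectBound u v n m k ≤ u a * v m + (u b - u a) * v y →
      rectBound u v n m k ≤ u x₁ * v m + (u x₂ - u x₁) * v y := by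
    intro a b ha hax hxk hb hab hy0 hle
    rcases hax.eq_or_lt with rfl | hlt
    · have : b = x₂ := by
        have : y * (b - x₂) = 0 := by linarith
        rcases mul_eq_zero.1 this with h | h <;> linarith
      rwa [← this]
    set c := k / m
    have hcm : m * c = k := mul_div_cancel₀ _ hm.ne'
    have hac : 0 < c - a := by linarith
    set t := (x₁ - a) / (c - a)
    have ht0 : 0 ≤ t := div_nonneg (by linarith) hac.le
    have ht1 : 0 ≤ 1 - t := sub_nonneg.2 ((div_le_one hac).2 (by linarith))
    have e₁ : (1 - t) • a + t • c = x₁ := by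
      have : t * (c - a) = x₁ - a := div_mul_cancel₀ _ hac.ne'
      simp only [smul_eq_mul]; linear_combination this
    have e₂ : (1 - t) • b + t • c = x₂ := by
      simp only [smul_eq_mul] at e₁ ⊢
      refine mul_left_cancel₀ hy0.ne' ?_
      linear_combination (1 - t) * hab - hxy - (m - y) * e₁ + t * hcm
    have c₁ := hu.concaveOn.2 (mem_Ici.2 ha) (mem_Ici.2 hxb.1) ht1 ht0 (sub_add_cancel 1 t)
    have c₂ := hu.concaveOn.2 (mem_Ici.2 hb) (mem_Ici.2 hxb.1) ht1 ht0 (sub_add_cancel 1 t)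
    rw [e₁] at c₁
    rw [e₂] at c₂
    simp only [smul_eq_mul] at c₁ c₂
    calc rectBound u v n m k
        = (1 - t) * rectBound u v n m k + t * rectBound u v n m k := by ring
      _ ≤ (1 - t) * (u a * v m + (u b - u a) * v y) + t * (u c * v m) := by gcongr
      _ = ((1 - t) * u a + t * u c) * (v m - v y) + ((1 - t) * u b + t * u c) * v y := by ring
      _ ≤ u x₁ * (v m - v y) + u x₂ * v y := by gcongr
      _ = u x₁ * v m + (u x₂ - u x₁) * v y := by ring
  have hxk : x₁ ≤ k / m := by
    rw [le_div_iff₀ hm, ← hxy]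
    nlinarith [mul_nonneg hy.1 (sub_nonneg.2 h₁₂)]
  rcases hy.1.eq_or_lt with rfl | hy0
  · have : k / m = x₁ := by rw [div_eq_iff hm.ne', ← hxy]; ring
    rwa [hv.map_zero, mul_zero, add_zero, ← this]
  -- Moving along the line away from `(k / m, k / m)`, either `x₁` reaches 0 first, leaving a
  -- rectangle of height `y`, or `x₂` reaches `n` first, leaving an L-shape.
  rcases le_or_gt k (n * y) with hky | hky
  · refine conc 0 (k / y) le_rfl h₁ hxk (by positivity) (by field_simp; ring) hy0 ?_
    rw [hu.map_zero, zero_mul, zero_add, sub_zero]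
    exact rectBound_le_of_mul_eq hu hv hk.1 ⟨by positivity, (div_le_iff₀ hy0).2 hky⟩ hy
      (div_mul_cancel₀ _ hy0.ne')
  · have hym : 0 < m - y := by
      by_contra! h
      have : y = m := le_antisymm hy.2 (by linarith)
      rw [this] at hky
      linarith [hk.2]
    set a := (k - n * y) / (m - y)
    have ha : a * (m - y) = k - n * y := div_mul_cancel₀ _ hym.ne'
    have ha0 : 0 ≤ a := div_nonneg (by linarith) hym.le
    have hax : a ≤ x₁ := by
      rw [div_le_iff₀ hym]
      nlinarith [mul_le_mul_of_nonneg_left h₂ hy.1]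
    refine conc a n ha0 hax hxk hn.le (by linear_combination ha) hy0 ?_
    have := rectBound_le_lshape hu hv hul hvl hk (x := a) (y := y)
      ⟨ha0, hax.trans (h₁₂.trans h₂)⟩ hy (by linear_combination ha)
    linarith

end LShape

/-! ### Independent sets adapted to a flag. -/

section LinearAlgebra

variable {ι V : Type*} [AddCommGroup V] [Module ℂ V]

/-- A flag of index sets has a linearly independent subset spanning each of its members. -/
lemma exists_linearIndepOn_flag [Fintype ι] [FiniteDimensional ℂ V] (a : ι → V) (T : ℕ → Set ι)
    (hT : Antitone T) (N : ℕ) :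
    ∃ I ⊆ T 0, LinearIndepOn ℂ a I ∧ ∀ y ≤ N,
      Module.finrank ℂ (Submodule.span ℂ (a '' T y)) ≤ (I ∩ T y).ncard := by
  classical
  induction N generalizing T with
  | zero =>
    obtain ⟨I, hI, -, hspan, hind⟩ :=
      exists_linearIndepOn_extension (linearIndepOn_empty ℂ a) (empty_subset (T 0))
    refine ⟨I, hI, hind, fun y hy => ?_⟩
    obtain rfl : y = 0 := Nat.le_zero.1 hy
    rw [inter_eq_left.2 hI]
    refine (Submodule.finrank_mono (Submodule.span_le.2 hspan)).trans ?_
    have := finrank_span_eq_card (R := ℂ) (b := fun i : I => a i) hind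
    rw [image_eq_range, this, ncard_eq_toFinset_card']
    simp
  | succ N ih =>
    -- Greedy choice from the smallest set outwards: the shifted flag is treated first, and its
    -- independent set is extended inside `T 0`.
    obtain ⟨J, hJ, hJind, hJc⟩ := ih (fun y => T (y + 1)) fun x y h => hT (by omega)
    obtain ⟨I, hI, hJI, hspan, hind⟩ :=
      exists_linearIndepOn_extension hJind (hJ.trans (hT (Nat.zero_le 1)))
    refine ⟨I, hI, hind, fun y hy => ?_⟩
    rcases y with _ | y
    · rw [inter_eq_left.2 hI]
      refine (Submodule.finrank_mono (Submodule.span_le.2 hspan)).trans ?_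
      have := finrank_span_eq_card (R := ℂ) (b := fun i : I => a i) hind
      rw [image_eq_range, this, ncard_eq_toFinset_card']
      simp
    · exact (hJc y (by omega)).trans
        (ncard_le_ncard (inter_subset_inter_left _ hJI) (toFinite _))

end LinearAlgebra

/-! ### Ranks of column sets of a Kronecker product. -/

section Kronecker

variable {m n m' n' : Type*}

lemma finrank_span_kronecker_swap (A : Matrix m n ℂ) (B : Matrix m' n' ℂ) (S : Set (n × n')) :
    Module.finrank ℂ (Submodule.span ℂ ((B ⊗ₖ A).col '' (Prod.swap '' S))) =
      Module.finrank ℂ (Submodule.span ℂ ((A ⊗ₖ B).col '' S)) := by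
  rw [← LinearEquiv.finrank_map_eq (LinearEquiv.funCongrLeft ℂ ℂ (Equiv.prodComm m' m)),
    Submodule.map_span, image_image, image_image]
  have h : (fun p : n × n' => (B ⊗ₖ A).col p.swap) = fun p =>
      LinearEquiv.funCongrLeft ℂ ℂ (Equiv.prodComm m' m) ((A ⊗ₖ B).col p) := by
    ext p r
    simp [Matrix.col, Matrix.kroneckerMap_apply, LinearEquiv.funCongrLeft, LinearMap.funLeft,
      mul_comm]
  rw [h]
  rfl

variable [Fintype m] [Fintype m'] [Fintype n']

/-- The columns of `A ⊗ₖ B` indexed by `S` have rank at least the sum, over an independent family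
of columns of `A`, of the ranks of the corresponding fibers of `S`. -/
lemma sum_finrank_le_finrank_kronecker (A : Matrix m n ℂ) (B : Matrix m' n' ℂ)
    (S : Set (n × n')) (I : Finset n) (hI : LinearIndepOn ℂ A.col (I : Set n)) :
    ∑ i ∈ I, Module.finrank ℂ (Submodule.span ℂ (B.col '' {j | (i, j) ∈ S})) ≤
      Module.finrank ℂ (Submodule.span ℂ ((A ⊗ₖ B).col '' S)) := by
  classical
  have hJ : ∀ i, ∃ J : Finset n', (J : Set n') ⊆ {j | (i, j) ∈ S} ∧
      LinearIndepOn ℂ B.col (J : Set n') ∧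
      Module.finrank ℂ (Submodule.span ℂ (B.col '' {j | (i, j) ∈ S})) ≤ J.card := by
    intro i
    obtain ⟨J, hJs, hJi, hJc⟩ :=
      exists_linearIndepOn_flag B.col (fun _ => {j | (i, j) ∈ S}) antitone_const 0
    refine ⟨J.toFinset, by simpa using hJs, by simpa using hJi, ?_⟩
    have := hJc 0 le_rfl
    rwa [inter_eq_left.2 hJs, ncard_eq_toFinset_card'] at this
  choose J hJS hJi hJc using hJ
  refine (Finset.sum_le_sum fun i _ => hJc i).trans ?_
  rw [← Finset.card_sigma]
  have hind : LinearIndependent ℂ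
      (fun p : (I.sigma J : Finset (Σ _ : n, n')) => (A ⊗ₖ B).col (p.1.1, p.1.2)) := by
    rw [Fintype.linearIndependent_iff]
    intro c hc
    set d : n → n' → ℂ := fun i j => if h : (⟨i, j⟩ : Σ _ : n, n') ∈ I.sigma J then c ⟨_, h⟩ else 0
      with hd
    have hc' : ∀ r r', ∑ i ∈ I, ∑ j ∈ J i, d i j * (A r i * B r' j) = 0 := by
      intro r r'
      have := congrFun hc (r, r')
      rw [Finset.sum_apply] at this
      rw [← Finset.sum_sigma I J (fun p : Σ _ : n, n' => d p.1 p.2 * (A r p.1 * B r' p.2)),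
        ← Finset.sum_coe_sort, ← this.trans (Pi.zero_apply _)]
      refine Finset.sum_congr rfl fun p _ => ?_
      have hp : (⟨p.1.1, p.1.2⟩ : Σ _ : n, n') ∈ I.sigma J := p.2
      simp [hd, hp, Matrix.col, Matrix.kroneckerMap_apply, -Finset.mem_sigma]
    -- With the row `r'` of `B` fixed, the relation is one among the columns of `A` in `I`; its
    -- coefficients vanish and are in turn relations among columns of `B`.
    have h₁ : ∀ i ∈ I, ∀ r', ∑ j ∈ J i, d i j * B r' j = 0 := by
      intro i hi r'
      rw [linearIndepOn_finset_iff] at hI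
      refine hI (fun i => ∑ j ∈ J i, d i j * B r' j) ?_ i hi
      ext r
      rw [Finset.sum_apply, Pi.zero_apply, ← hc' r r']
      refine Finset.sum_congr rfl fun i _ => ?_
      rw [Pi.smul_apply, smul_eq_mul, Finset.sum_mul]
      refine Finset.sum_congr rfl fun j _ => ?_
      simp only [Matrix.col, Matrix.transpose_apply]
      ring
    rintro ⟨⟨i, j⟩, hp⟩
    obtain ⟨hi, hj⟩ := Finset.mem_sigma.1 hp
    have := hJi i
    rw [linearIndepOn_finset_iff] at this
    have h₂ := this (d i) (by
      ext r'
      rw [Finset.sum_apply, Pi.zero_apply, ← h₁ i hi r']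
      rfl) j hj
    simpa [hd, hp, -Finset.mem_sigma] using h₂
  have hcard := finrank_span_eq_card hind
  rw [Fintype.card_coe] at hcard
  rw [← hcard]
  refine Submodule.finrank_mono (Submodule.span_mono ?_)
  rintro _ ⟨⟨⟨i, j⟩, hp⟩, rfl⟩
  exact ⟨(i, j), hJS i (Finset.mem_sigma.1 hp).2, rfl⟩

end Kronecker

/-! ### Rank expansion in terms of sets of columns. -/

section RankExpansion

variable {m n : Type*} [Fintype n] [DecidableEq n]

lemma mul_selectionMatrix (A : Matrix m n ℂ) {k : ℕ} (e : Fin k ↪ n) :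
    A * selectionMatrix e = A.submatrix id e := by
  ext i j
  simp [selectionMatrix, Matrix.mul_apply, Matrix.one_apply]

lemma rank_mul_selectionMatrix (A : Matrix m n ℂ) {k : ℕ} (e : Fin k ↪ n) :
    (A * selectionMatrix e).rank = Module.finrank ℂ (Submodule.span ℂ (A.col '' range e)) := by
  rw [mul_selectionMatrix, Matrix.rank_eq_finrank_span_cols, ← range_comp]
  rfl

lemma rankExpansion_le (A : Matrix m n ℂ) (T : Finset n) :
    rankExpansion A T.card ≤ Module.finrank ℂ (Submodule.span ℂ (A.col '' (T : Set n))) := by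
  refine Nat.sInf_le ⟨T.equivFin.symm.toEmbedding.trans (Function.Embedding.subtype _), ?_⟩
  rw [rank_mul_selectionMatrix]
  suffices h : (T : Set n) = range
      (T.equivFin.symm.toEmbedding.trans (Function.Embedding.subtype (· ∈ T))) by rw [← h]
  ext x
  simp only [Finset.mem_coe, mem_range, Function.Embedding.trans_apply, Equiv.coe_toEmbedding,
    Function.Embedding.subtype_apply]
  exact ⟨fun h => ⟨T.equivFin ⟨x, h⟩, by simp⟩, fun ⟨y, hy⟩ => hy ▸ (T.equivFin.symm y).2⟩

lemma exists_rankExpansion_eq (A : Matrix m n ℂ) {k : ℕ} (hk : k ≤ Fintype.card n) :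
    ∃ T : Finset n, T.card = k ∧
      rankExpansion A k = Module.finrank ℂ (Submodule.span ℂ (A.col '' (T : Set n))) := by
  obtain ⟨T₀, -, hT₀⟩ := Finset.exists_subset_card_eq (s := (Finset.univ : Finset n)) hk
  have hne : {r : ℕ | ∃ e : Fin k ↪ n, r = (A * selectionMatrix e).rank}.Nonempty :=
    ⟨_, (T₀.equivFinOfCardEq hT₀).symm.toEmbedding.trans (Function.Embedding.subtype _), rfl⟩
  obtain ⟨e, he⟩ := Nat.sInf_mem hne
  refine ⟨Finset.univ.map e, by simp, ?_⟩
  rw [rankExpansion, he, rank_mul_selectionMatrix, Finset.coe_map, Finset.coe_univ, image_univ]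

end RankExpansion

/-! ### Splitting a mean into two-point means. -/

/-- A convex combination with mean `c` is a combination of two-point combinations with mean `c`. -/
lemma Convex.sum_mem_of_two_point {ι E : Type*} [AddCommGroup E] [Module ℝ E] {K : Set E}
    (hK : Convex ℝ K) (t : Finset ι) (p X : ι → ℝ) (e : ι → E) (c : ℝ)
    (hp : ∀ i ∈ t, 0 ≤ p i) (hp1 : ∑ i ∈ t, p i = 1) (hX : ∑ i ∈ t, p i * X i = c)
    (heq : ∀ i ∈ t, X i = c → e i ∈ K)
    (hlt : ∀ i ∈ t, ∀ j ∈ t, X i < c → c ≤ X j →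
      ((X j - c) / (X j - X i)) • e i + ((c - X i) / (X j - X i)) • e j ∈ K) :
    ∑ i ∈ t, p i • e i ∈ K := by
  classical
  set L := t.filter fun i => X i < c
  set U := t.filter fun i => ¬ X i < c with hU
  have hLt : ∀ i ∈ L, i ∈ t ∧ X i < c := fun i hi => Finset.mem_filter.1 hi
  have hUt : ∀ i ∈ U, i ∈ t ∧ c ≤ X i := fun i hi => by
    simpa [hU] using hi
  set N := ∑ i ∈ L, p i * (c - X i) with hN
  have hsplit : N = ∑ j ∈ U, p j * (X j - c) := by
    have h : ∑ i ∈ t, p i * (c - X i) = 0 := by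
      simp only [mul_sub, Finset.sum_sub_distrib, ← Finset.sum_mul, hp1, hX]; ring
    rw [← Finset.sum_filter_add_sum_filter_not t (fun i => X i < c)] at h
    rw [hN, eq_neg_of_add_eq_zero_left h, ← Finset.sum_neg_distrib]
    exact Finset.sum_congr rfl fun i _ => by ring
  have hN0 : 0 ≤ N := Finset.sum_nonneg fun i hi =>
    mul_nonneg (hp i (hLt i hi).1) (by linarith [(hLt i hi).2])
  rcases hN0.eq_or_lt with h0 | hNpos
  · have hzL : ∀ i ∈ L, p i = 0 := fun i hi => by
      have := (Finset.sum_eq_zero_iff_of_nonneg fun i hi =>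
        mul_nonneg (hp i (hLt i hi).1) (by linarith [(hLt i hi).2])).1 h0.symm i hi
      exact (mul_eq_zero.1 this).resolve_right (by linarith [(hLt i hi).2])
    have hzU : ∀ i ∈ U, p i = 0 ∨ X i = c := fun i hi => by
      have := (Finset.sum_eq_zero_iff_of_nonneg fun i hi =>
        mul_nonneg (hp i (hUt i hi).1) (by linarith [(hUt i hi).2])).1
          (hsplit.symm.trans h0.symm) i hi
      exact (mul_eq_zero.1 this).imp_right sub_eq_zero.1
    have hz : ∀ i ∈ t, X i ≠ c → p i = 0 := fun i hi hne => by
      by_cases h : X i < c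
      · exact hzL i (Finset.mem_filter.2 ⟨hi, h⟩)
      · exact (hzU i (Finset.mem_filter.2 ⟨hi, h⟩)).resolve_right hne
    have hs : ∀ i ∈ t, i ∉ t.filter (fun i => X i = c) → p i = 0 := fun i hi hni =>
      hz i hi fun h => hni (Finset.mem_filter.2 ⟨hi, h⟩)
    rw [← Finset.sum_subset (Finset.filter_subset (fun i => X i = c) t)
      fun i hi hni => by rw [hs i hi hni, zero_smul]]
    refine hK.sum_mem (fun i hi => hp i (Finset.mem_filter.1 hi).1) ?_
      fun i hi => heq i (Finset.mem_filter.1 hi).1 (Finset.mem_filter.1 hi).2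
    rw [Finset.sum_subset (Finset.filter_subset (fun i => X i = c) t) hs, hp1]
  · have hpos : ∀ i ∈ L, ∀ j ∈ U, 0 < X j - X i := fun i hi j hj => by
      linarith [(hLt i hi).2, (hUt j hj).2]
    -- `N` is both the total deficit below `c` and the total excess above it. Weighting the pair
    -- `(i, j)` by `p i * p j * (X j - X i) / N` restores the mass of every point.
    have key : ∑ i ∈ t, p i • e i = ∑ q ∈ L ×ˢ U, (p q.1 * p q.2 * (X q.2 - X q.1) / N) •
        (((X q.2 - c) / (X q.2 - X q.1)) • e q.1 + ((c - X q.1) / (X q.2 - X q.1)) • e q.2) := by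
      have hterm : ∀ i ∈ L, ∀ j ∈ U, (p i * p j * (X j - X i) / N) •
          (((X j - c) / (X j - X i)) • e i + ((c - X i) / (X j - X i)) • e j) =
          ((p j * (X j - c)) * (p i / N)) • e i + ((p i * (c - X i)) * (p j / N)) • e j := by
        intro i hi j hj
        have := (hpos i hi j hj).ne'
        rw [smul_add, smul_smul, smul_smul]
        congr 2 <;> field_simp
      rw [Finset.sum_product, Finset.sum_congr rfl fun i hi => Finset.sum_congr rfl (hterm i hi)]
      simp only [Finset.sum_add_distrib]
      rw [Finset.sum_comm (s := L) (t := U) (f := fun i j =>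
        ((p i * (c - X i)) * (p j / N)) • e j)]
      simp only [← Finset.sum_smul, ← Finset.sum_mul]
      rw [← hsplit, ← hN, ← Finset.sum_filter_add_sum_filter_not t (fun i => X i < c)]
      simp only [mul_div_cancel₀ _ hNpos.ne']
      rfl
    rw [key]
    refine hK.sum_mem (fun q hq => ?_) ?_ fun q hq => ?_
    · obtain ⟨h₁, h₂⟩ := Finset.mem_product.1 hq
      exact div_nonneg (mul_nonneg (mul_nonneg (hp _ (hLt _ h₁).1) (hp _ (hUt _ h₂).1))
        (hpos _ h₁ _ h₂).le) hNpos.le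
    · have hterm : ∀ i j, p i * p j * (X j - X i) / N =
          (p j * (X j - c)) * (p i / N) + (p i * (c - X i)) * (p j / N) := fun i j => by ring
      rw [Finset.sum_product, Finset.sum_congr rfl fun i _ => Finset.sum_congr rfl
        fun j _ => hterm i j]
      simp only [Finset.sum_add_distrib]
      rw [Finset.sum_comm (s := L) (t := U) (f := fun i j => (p i * (c - X i)) * (p j / N))]
      simp only [← Finset.sum_mul]
      rw [← hsplit, ← hN, ← hp1, ← Finset.sum_filter_add_sum_filter_not t (fun i => X i < c)]
      simp only [mul_div_cancel₀ _ hNpos.ne']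
      rfl
    · obtain ⟨h₁, h₂⟩ := Finset.mem_product.1 hq
      exact hlt _ (hLt _ h₁).1 _ (hUt _ h₂).1 (hLt _ h₁).2 (hUt _ h₂).2

/-! ### Column heights compared with shapes of equal area. -/

section Heights

variable {ι : Type*} [Fintype ι] {u v : ℝ → ℝ} {n m : ℝ}

lemma sum_range_ite_lt {a L : ℕ} (h : a ≤ L) (c : ℝ) :
    ∑ y ∈ Finset.range L, (if y < a then c else 0) = a * c := by
  rw [← Finset.sum_filter, Finset.sum_const, nsmul_eq_mul]
  congr 2
  refine (congrArg Finset.card ?_).trans (Finset.card_range a)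
  ext y
  simp only [Finset.mem_filter, Finset.mem_range]
  omega

lemma sum_card_filter_lt (s : ι → ℕ) {L : ℕ} (hs : ∀ i, s i ≤ L) :
    ∑ y ∈ Finset.range L, ((Finset.univ.filter fun i => y < s i).card : ℝ) = ∑ i, (s i : ℝ) := by
  simp only [Finset.card_filter, Nat.cast_sum, Nat.cast_ite, Nat.cast_one, Nat.cast_zero]
  rw [Finset.sum_comm]
  refine Finset.sum_congr rfl fun i _ => ?_
  rw [sum_range_ite_lt (hs i), mul_one]

/-- The bound when `k ≤ du * m`: by concavity, the heights are compared with rectangles. -/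
lemma rectBound_le_sum_of_le (hu : IsProfile u n) (hv : IsProfile v m) (s : ι → ℕ) (I : Finset ι)
    (hcard : (Fintype.card ι : ℝ) ≤ n)
    (hI : ∀ y, (Finset.univ.filter fun i => y < s i).Nonempty →
      max 1 (u (Finset.univ.filter fun i => y < s i).card) ≤ (I.filter fun i => y < s i).card)
    {k : ℝ} (hk : ∑ i, (s i : ℝ) = k) (hk0 : 0 < k) (hkm : k ≤ pseudoInv u 1 * m) :
    rectBound u v n m k ≤ ∑ i ∈ I, max 1 (v (s i)) := by
  set X : ℕ → ℝ := fun y => (Finset.univ.filter fun i => y < s i).card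
  set c : ℕ → ℝ := fun y => (I.filter fun i => y < s i).card with hc
  have hXanti : ∀ y, X y ≤ X 0 := fun y => Nat.cast_le.2 <| Finset.card_le_card <|
    Finset.monotone_filter_right _ fun i _ hi => (Nat.zero_le y).trans_lt hi
  have hXn : ∀ y, X y ≤ n := fun y => (Nat.cast_le.2 (Finset.card_le_univ _)).trans hcard
  have hX0 : ∀ y, 0 ≤ X y := fun y => Nat.cast_nonneg _
  have hXc : ∀ y, 0 < X y → max 1 (u (X y)) ≤ c y := fun y hy =>
    hI y (Finset.card_pos.1 (Nat.cast_pos.1 hy))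
  have hsX : ∀ i y, y < s i → 0 < X y := fun i y h =>
    Nat.cast_pos.2 (Finset.card_pos.2 ⟨i, Finset.mem_filter.2 ⟨Finset.mem_univ _, h⟩⟩)
  have hpos0 : 0 < X 0 := by
    obtain ⟨i, -, hi⟩ : ∃ i ∈ Finset.univ, 0 < (s i : ℝ) := by
      by_contra! h
      exact (hk ▸ Finset.sum_nonpos h).not_gt hk0
    exact hsX i 0 (Nat.cast_pos.1 hi)
  have hcI : c 0 ≤ ∑ i ∈ I, max 1 (v (s i)) := by
    calc c 0 ≤ I.card := Nat.cast_le.2 (Finset.card_filter_le _ _)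
      _ = ∑ i ∈ I, (1 : ℝ) := by simp
      _ ≤ _ := Finset.sum_le_sum fun i _ => le_max_left _ _
  have hdu := hu.pseudoInv_pos
  have hdv := hv.pseudoInv_pos
  rcases le_or_gt k (pseudoInv u 1 * pseudoInv v 1) with hkd | hkd
  · exact (rectBound_le_one hu hv hkd).trans (((le_max_left _ _).trans (hXc 0 hpos0)).trans hcI)
  -- The support of `s` is too wide here for height `dv`; the count of `I` alone beats the rectangle
  -- of height `dv`.
  rcases lt_or_ge k (X 0 * pseudoInv v 1) with hkX | hkX
  · have h₁ : pseudoInv u 1 ≤ k / pseudoInv v 1 := (le_div_iff₀ hdv).2 hkd.le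
    have h₂ : k / pseudoInv v 1 ≤ X 0 := (div_le_iff₀ hdv).2 hkX.le
    have := rectBound_le (k := k) hu hv ⟨h₁, h₂.trans (hXn 0)⟩ ⟨le_rfl, hv.pseudoInv_le⟩
      (div_mul_cancel₀ _ hdv.ne').ge
    rw [hv.map_pseudoInv, mul_one] at this
    exact this.trans ((hu.mono (hdu.le.trans h₁) h₂).trans
      (((le_max_right _ _).trans (hXc 0 hpos0)).trans hcI))
  set L := Finset.univ.sup s
  have hsL : ∀ i, s i ≤ L := fun i => Finset.le_sup (Finset.mem_univ i)
  have hsum : ∑ y ∈ Finset.range L, X y / k = 1 := by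
    rw [← Finset.sum_div, sum_card_filter_lt s hsL, hk, div_self hk0.ne']
  -- `s i` is the mean, with weights `X y / k`, of the heights at `i` of the rectangles of width `X
  -- y` and height `k / X y`.
  have hjensen : ∀ i ∈ I, ∑ y ∈ Finset.range L, X y / k *
      (if y < s i then v (k / X y) else 0) ≤ max 1 (v (s i)) := by
    intro i _
    refine le_trans ?_ (le_max_right _ _)
    have := hv.concaveOn.le_map_sum (t := Finset.range L) (w := fun y => X y / k)
      (p := fun y => if y < s i then k / X y else 0)
      (fun y _ => div_nonneg (hX0 y) hk0.le) hsum (fun y _ => by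
        split_ifs
        · exact mem_Ici.2 (div_nonneg hk0.le (hX0 y))
        · exact mem_Ici.2 le_rfl)
    convert this using 1
    · refine Finset.sum_congr rfl fun y _ => ?_
      split_ifs <;> simp [hv.map_zero]
    · congr 1
      rw [← mul_one (s i : ℝ), ← sum_range_ite_lt (hsL i)]
      refine Finset.sum_congr rfl fun y _ => ?_
      split_ifs with h
      · have := (hsX i y h).ne'
        rw [smul_eq_mul]; field_simp
      · simp
  have hterm : ∀ y, X y / k * rectBound u v n m k ≤ X y / k * (c y * v (k / X y)) := by
    intro y
    rcases (hX0 y).eq_or_lt with h0 | hXy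
    · simp [← h0]
    refine mul_le_mul_of_nonneg_left ?_ (div_nonneg hXy.le hk0.le)
    have hvk : 0 ≤ v (k / X y) := hv.nonneg (div_nonneg hk0.le hXy.le)
    rcases le_or_gt (pseudoInv u 1) (X y) with hd | hd
    · have hm := hv.pos
      refine (rectBound_le hu hv ⟨hd, hXn y⟩ (y := k / X y) ⟨?_, ?_⟩
        (mul_div_cancel₀ _ hXy.ne').ge).trans
        (mul_le_mul_of_nonneg_right ((le_max_right _ _).trans (hXc y hXy)) hvk)
      · rw [le_div_iff₀ hXy, mul_comm]
        exact (mul_le_mul_of_nonneg_right (hXanti y) hdv.le).trans hkX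
      · rw [div_le_iff₀ hXy, mul_comm]
        exact hkm.trans (mul_le_mul_of_nonneg_right hd hm.le)
    -- A level narrower than `du` gives no admissible rectangle; widening it to `du` lowers its
    -- height, and `c y ≥ 1 = u du` covers the width.
    · have h := rectBound_le (k := k) hu hv ⟨le_rfl, hu.pseudoInv_le⟩
        (y := k / pseudoInv u 1) ⟨(le_div_iff₀' hdu).2 hkd.le, (div_le_iff₀' hdu).2 hkm⟩
        (mul_div_cancel₀ _ hdu.ne').ge
      rw [hu.map_pseudoInv, one_mul] at h
      calc _ ≤ v (k / pseudoInv u 1) := h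
        _ ≤ v (k / X y) := hv.mono (by positivity) (by gcongr)
        _ ≤ c y * v (k / X y) :=
          le_mul_of_one_le_left hvk ((le_max_left _ _).trans (hXc y hXy))
  calc rectBound u v n m k = ∑ y ∈ Finset.range L, X y / k * rectBound u v n m k := by
        rw [← Finset.sum_mul, hsum, one_mul]
    _ ≤ ∑ y ∈ Finset.range L, X y / k * (c y * v (k / X y)) :=
        Finset.sum_le_sum fun y _ => hterm y
    _ = ∑ i ∈ I, ∑ y ∈ Finset.range L, X y / k * (if y < s i then v (k / X y) else 0) := by
        rw [Finset.sum_comm]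
        refine Finset.sum_congr rfl fun y _ => ?_
        rw [← Finset.mul_sum, ← Finset.sum_filter, Finset.sum_const, nsmul_eq_mul]
    _ ≤ _ := Finset.sum_le_sum hjensen

/-- The bound when `k ≥ max (n * dv) (du * m)`: by concavity, the heights are compared with
two-step shapes. -/
lemma rectBound_le_sum_of_ge {M : ℕ} (hu : IsProfile u n) (hv : IsProfile v M)
    (hul : LogLogConvexOn (Ioo 0 n) (fun x => u n - u (n - x)))
    (hvl : LogLogConvexOn (Ioo 0 (M : ℝ)) (fun x => v M - v (M - x)))
    (s : ι → ℕ) (hs : ∀ i, s i ≤ M) (I : Finset ι) (hcard : (Fintype.card ι : ℝ) ≤ n)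
    (hI : ∀ y, u (Finset.univ.filter fun i => y < s i).card ≤ (I.filter fun i => y < s i).card)
    {k : ℝ} (hk : ∑ i, (s i : ℝ) = k)
    (hkm : k ∈ Icc (max (n * pseudoInv v 1) (pseudoInv u 1 * M)) (n * M)) :
    rectBound u v n M k ≤ ∑ i ∈ I, v (s i) := by
  set X : ℕ → ℝ := fun y => (Finset.univ.filter fun i => y < s i).card
  set c : ℕ → ℝ := fun y => (I.filter fun i => y < s i).card with hc
  have hXn : ∀ y, X y ≤ n := fun y => (Nat.cast_le.2 (Finset.card_le_univ _)).trans hcard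
  have hX0 : ∀ y, 0 ≤ X y := fun y => Nat.cast_nonneg _
  have hM : (0 : ℝ) < M := hv.pos
  have hXanti : ∀ y z, z ≤ y → X y ≤ X z := fun y z h => Nat.cast_le.2 <| Finset.card_le_card <|
    Finset.monotone_filter_right _ fun i _ hi => h.trans_lt hi
  set K : Set (ι → ℝ) := {w | (∀ i, 0 ≤ w i) ∧ rectBound u v n M k ≤ ∑ i ∈ I, v (w i)}
  have hKconv : Convex ℝ K := by
    intro w hw w' hw' a b ha hb hab
    refine ⟨fun i => add_nonneg (mul_nonneg ha (hw.1 i)) (mul_nonneg hb (hw'.1 i)), ?_⟩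
    calc rectBound u v n M k
        = a * rectBound u v n M k + b * rectBound u v n M k := by rw [← add_mul, hab, one_mul]
      _ ≤ a * ∑ i ∈ I, v (w i) + b * ∑ i ∈ I, v (w' i) :=
          add_le_add (mul_le_mul_of_nonneg_left hw.2 ha) (mul_le_mul_of_nonneg_left hw'.2 hb)
      _ = ∑ i ∈ I, (a * v (w i) + b * v (w' i)) := by
          rw [Finset.sum_add_distrib, Finset.mul_sum, Finset.mul_sum]
      _ ≤ _ := Finset.sum_le_sum fun i _ => hv.concaveOn.2 (hw.1 i) (hw'.1 i) ha hb hab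
  -- `s` is the uniform mean of these full-height shapes, whose widths `X y` average to `k / M`. A
  -- two-point mean of width `k / M` is a two-step shape of area `k`.
  set e : ℕ → ι → ℝ := fun y i => if y < s i then M else 0 with he
  have he0 : ∀ y i, 0 ≤ e y i := fun y i => by
    simp only [he]; split_ifs <;> positivity
  have hmem : (∑ y ∈ Finset.range M, (1 / (M : ℝ)) • e y) ∈ K := by
    refine hKconv.sum_mem_of_two_point _ _ X e (k / M) (fun _ _ => by positivity) ?_ ?_ ?_ ?_
    · rw [Finset.sum_const, Finset.card_range, nsmul_eq_mul, mul_one_div_cancel hM.ne']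
    · rw [← Finset.mul_sum, sum_card_filter_lt s hs, hk]; ring
    · intro y _ hy
      refine ⟨he0 y, ?_⟩
      have h₂ := rectBound_le_two_step hu hv hul hvl hkm (hX0 y) le_rfl (hXn y)
        (y := 0) ⟨le_rfl, hM.le⟩ (by rw [hy]; field_simp; ring)
      rw [sub_self, zero_mul, add_zero] at h₂
      refine (h₂.trans (mul_le_mul_of_nonneg_right (hI y) (hv.nonneg hM.le))).trans_eq ?_
      rw [← nsmul_eq_mul, ← Finset.sum_const, Finset.sum_filter]
      refine Finset.sum_congr rfl fun i _ => ?_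
      simp only [he]
      split_ifs
      · rfl
      · exact hv.map_zero.symm
    · intro y _ z _ hy hz
      have hXX : 0 < X z - X y := by linarith
      have hzy : z < y := by
        by_contra! h
        linarith [hXanti z y h]
      set a := (X z - k / M) / (X z - X y)
      set b := (k / M - X y) / (X z - X y)
      have ha : 0 ≤ a := div_nonneg (by linarith) hXX.le
      have hb : 0 ≤ b := div_nonneg (by linarith) hXX.le
      have hab : a + b = 1 := by simp only [a, b]; field_simp; ring
      have hbM : b * M ∈ Icc (0 : ℝ) M :=
        ⟨by positivity, mul_le_of_le_one_left hM.le (by linarith)⟩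
      refine ⟨fun i => add_nonneg (mul_nonneg ha (he0 y i)) (mul_nonneg hb (he0 z i)), ?_⟩
      have hbX : b * (X z - X y) = k / M - X y := div_mul_cancel₀ _ hXX.ne'
      have h₂ := rectBound_le_two_step hu hv hul hvl hkm (hX0 y) (by linarith) (hXn z) hbM
        (by linear_combination (M : ℝ) * hbX + div_mul_cancel₀ k hM.ne')
      have hval : ∑ i ∈ I, v ((a • e y + b • e z) i) =
          c y * (v M - v (b * M)) + c z * v (b * M) := by
        simp only [hc]
        rw [← nsmul_eq_mul, ← nsmul_eq_mul, ← Finset.sum_const, ← Finset.sum_const,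
          Finset.sum_filter, Finset.sum_filter, ← Finset.sum_add_distrib]
        refine Finset.sum_congr rfl fun i _ => ?_
        simp only [he, Pi.add_apply, Pi.smul_apply, smul_eq_mul]
        by_cases h₁ : y < s i
        · have : a * M + b * M = M := by rw [← add_mul, hab, one_mul]
          simp [h₁, hzy.trans h₁, this]
        · by_cases h₃ : z < s i
          · simp [h₁, h₃]
          · simp [h₁, h₃, hv.map_zero]
      rw [hval]
      have g₁ := mul_le_mul_of_nonneg_right (hI y)
        (sub_nonneg.2 (hv.mono hbM.1 hbM.2))
      have g₂ := mul_le_mul_of_nonneg_right (hI z) (hv.nonneg hbM.1)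
      calc _ ≤ _ := h₂
        _ = u (X y) * (v M - v (b * M)) + u (X z) * v (b * M) := by ring
        _ ≤ _ := add_le_add g₁ g₂
  refine hmem.2.trans_eq (Finset.sum_congr rfl fun i _ => ?_)
  congr 1
  rw [Finset.sum_apply]
  simp only [Pi.smul_apply, smul_eq_mul, he]
  rw [← Finset.mul_sum, sum_range_ite_lt (hs i)]
  field_simp

end Heights

/-! ### From column heights to the rank of the Kronecker product. -/

section Rank

variable {m n m' n' : Type*} [Fintype n] [Fintype n'] [DecidableEq n] [DecidableEq n'] {u v : ℝ → ℝ} {A : Matrix m n ℂ} {B : Matrix m' n' ℂ}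

/-- The profile is positive at positive arguments, so the rank, an integer, is at least 1 even where
the profile lies below 1. -/
lemma max_one_le_finrank {N : ℝ} (hA : IsRankExpansionLowerBound A u) (hu : IsProfile u N)
    {T : Finset n} (hT : T.Nonempty) :
    max 1 (u T.card) ≤ Module.finrank ℂ (Submodule.span ℂ (A.col '' (T : Set n))) := by
  have h : u T.card ≤ Module.finrank ℂ (Submodule.span ℂ (A.col '' (T : Set n))) :=
    (hA.le_rankExpansion _ hT.card_pos (Finset.card_le_univ T)).trans
      (Nat.cast_le.2 (rankExpansion_le A T))
  refine max_le ?_ h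
  have hpos := (hu.map_pos (Nat.cast_pos.2 hT.card_pos)).trans_le h
  exact_mod_cast hpos

variable [Fintype m] [Fintype m']

/-- An independent family of columns of `A` that spans every superlevel set of the fibers of `S`,
with the resulting lower bound on the rank of the columns of `A ⊗ₖ B` indexed by `S`. -/
lemma exists_independent_columns {N N' : ℝ} (hA : IsRankExpansionLowerBound A u)
    (hB : IsRankExpansionLowerBound B v) (hu : IsProfile u N) (hv : IsProfile v N')
    (S : Finset (n × n')) :
    ∃ I : Finset n,
      (∀ y, (Finset.univ.filter fun i => y < (Finset.univ.filter fun j => (i, j) ∈ S).card).Nonempty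
        → max 1 (u (Finset.univ.filter
          fun i => y < (Finset.univ.filter fun j => (i, j) ∈ S).card).card) ≤
        (I.filter fun i => y < (Finset.univ.filter fun j => (i, j) ∈ S).card).card) ∧
      ∑ i ∈ I, max 1 (v (Finset.univ.filter fun j => (i, j) ∈ S).card) ≤
        Module.finrank ℂ (Submodule.span ℂ ((A ⊗ₖ B).col '' (S : Set (n × n')))) := by
  set F : n → Finset n' := fun i => Finset.univ.filter fun j => (i, j) ∈ S with hF
  -- Level 0 of the flag consists of the nonempty fibers, so every index in `I` has one; levels
  -- beyond the number of columns of `B` are empty.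
  obtain ⟨I, hI0, hI, hIc⟩ := exists_linearIndepOn_flag A.col (fun y => {i | y < (F i).card})
    (fun x y h i hi => lt_of_le_of_lt h hi) (Fintype.card n')
  classical
  refine ⟨I.toFinset, fun y hy => ?_, ?_⟩
  · have hyN : y ≤ Fintype.card n' := by
      obtain ⟨i, hi⟩ := hy
      exact (Finset.mem_filter.1 hi).2.le.trans (Finset.card_le_univ _)
    refine (max_one_le_finrank hA hu hy).trans (Nat.cast_le.2 ?_)
    have := hIc y hyN
    rw [ncard_eq_toFinset_card'] at this
    have e₁ : ((Finset.univ.filter fun i => y < (F i).card : Finset n) : Set n) =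
        {i | y < (F i).card} := by simp
    have e₂ : (I.toFinset.filter fun i => y < (F i).card) =
        (I ∩ {i | y < (F i).card}).toFinset := by ext i; simp
    rwa [e₁, e₂]
  · refine le_trans ?_ (Nat.cast_le.2 (sum_finrank_le_finrank_kronecker A B S I.toFinset
      (by simpa using hI)))
    rw [Nat.cast_sum]
    refine Finset.sum_le_sum fun i hi => ?_
    have hne : (F i).Nonempty := Finset.card_pos.1 (hI0 (mem_toFinset.1 hi))
    have hcoe : ((F i : Finset n') : Set n') = {j | (i, j) ∈ (S : Set (n × n'))} := by simp [hF]
    rw [← hcoe]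
    exact max_one_le_finrank hB hv hne

lemma sum_card_fiber (S : Finset (n × n')) :
    ∑ i, ((Finset.univ.filter fun j => (i, j) ∈ S).card : ℝ) = S.card := by
  rw [← Nat.cast_sum, ← Finset.card_sigma]
  congr 1
  refine Finset.card_bij (fun p _ => (p.1, p.2)) ?_ ?_ ?_
  · rintro ⟨i, j⟩ h
    simpa using h
  · rintro ⟨i, j⟩ _ ⟨i', j'⟩ _ h
    simpa using h
  · rintro ⟨i, j⟩ h
    exact ⟨⟨i, j⟩, by simpa using h, rfl⟩

lemma rectBound_le_finrank_of_le (hA : IsRankExpansionLowerBound A u)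
    (hB : IsRankExpansionLowerBound B v) (hu : IsProfile u (Fintype.card n))
    (hv : IsProfile v (Fintype.card n')) {S : Finset (n × n')} (hS : S.Nonempty)
    (hk : (S.card : ℝ) ≤ pseudoInv u 1 * Fintype.card n') :
    rectBound u v (Fintype.card n) (Fintype.card n') S.card ≤
      Module.finrank ℂ (Submodule.span ℂ ((A ⊗ₖ B).col '' (S : Set (n × n')))) := by
  obtain ⟨I, hI, hsum⟩ := exists_independent_columns hA hB hu hv S
  exact (rectBound_le_sum_of_le hu hv _ I le_rfl hI (sum_card_fiber S)
    (Nat.cast_pos.2 hS.card_pos) hk).trans hsum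

lemma rectBound_le_finrank (hA : IsRankExpansionLowerBound A u)
    (hB : IsRankExpansionLowerBound B v) (hu : IsProfile u (Fintype.card n))
    (hv : IsProfile v (Fintype.card n'))
    (hul : LogLogConvexOn (Ioo 0 (Fintype.card n : ℝ))
      (fun x => u (Fintype.card n) - u (Fintype.card n - x)))
    (hvl : LogLogConvexOn (Ioo 0 (Fintype.card n' : ℝ))
      (fun x => v (Fintype.card n') - v (Fintype.card n' - x)))
    {S : Finset (n × n')} (hS : S.Nonempty) :
    rectBound u v (Fintype.card n) (Fintype.card n') S.card ≤
      Module.finrank ℂ (Submodule.span ℂ ((A ⊗ₖ B).col '' (S : Set (n × n')))) := by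
  rcases le_total (S.card : ℝ) (pseudoInv u 1 * Fintype.card n') with h₁ | h₁
  · exact rectBound_le_finrank_of_le hA hB hu hv hS h₁
  rcases le_total (S.card : ℝ) (Fintype.card n * pseudoInv v 1) with h₂ | h₂
  · have hcard : (S.map (Equiv.prodComm n n').toEmbedding).card = S.card := Finset.card_map _
    have := rectBound_le_finrank_of_le hB hA hv hu
      (S := S.map (Equiv.prodComm n n').toEmbedding) (hS.map) (by rw [hcard, mul_comm]; exact h₂)
    rw [hcard, Finset.coe_map] at this
    rw [rectBound_comm, ← finrank_span_kronecker_swap]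
    exact this
  obtain ⟨I, hI, hsum⟩ := exists_independent_columns hA hB hu hv S
  refine (rectBound_le_sum_of_ge hu hv hul hvl _ (fun i => Finset.card_le_univ _) I le_rfl
    (fun y => ?_) (sum_card_fiber S) ⟨max_le h₂ h₁, ?_⟩).trans
    ((Finset.sum_le_sum fun i _ => le_max_right _ _).trans hsum)
  · rcases Finset.eq_empty_or_nonempty (Finset.univ.filter
      fun i => y < (Finset.univ.filter fun j => (i, j) ∈ S).card) with h | h
    · rw [h, Finset.card_empty, Nat.cast_zero, hu.map_zero]
      exact Nat.cast_nonneg _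
    · exact (le_max_right _ _).trans (hI y h)
  · rw [← Nat.cast_mul, ← Fintype.card_prod]
    exact Nat.cast_le.2 (Finset.card_le_univ S)

/-- The rectangle bound, continued by a constant, is a rank expansion lower bound for `A ⊗ₖ B`. -/
lemma isRankExpansionLowerBound_rectBound (hA : IsRankExpansionLowerBound A u)
    (hB : IsRankExpansionLowerBound B v) (hu : IsProfile u (Fintype.card n))
    (hv : IsProfile v (Fintype.card n'))
    (hul : LogLogConvexOn (Ioo 0 (Fintype.card n : ℝ))
      (fun x => u (Fintype.card n) - u (Fintype.card n - x)))
    (hvl : LogLogConvexOn (Ioo 0 (Fintype.card n' : ℝ))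
      (fun x => v (Fintype.card n') - v (Fintype.card n' - x))) :
    IsRankExpansionLowerBound (A ⊗ₖ B) (fun k => rectBound u v (Fintype.card n) (Fintype.card n')
      (min k (Fintype.card n * Fintype.card n'))) where
  continuousOn := continuousOn_rectBound hu hv
  nonneg _ _ := rectBound_nonneg hu hv (min_le_right _ _)
  monotoneOn _ _ _ _ h := rectBound_mono hu hv (min_le_min_right _ h) (min_le_right _ _)
  le_rankExpansion k hk hkn := by
    obtain ⟨S, hS, he⟩ := exists_rankExpansion_eq (A ⊗ₖ B) hkn
    have hmin : min (k : ℝ) (Fintype.card n * Fintype.card n') = k := by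
      refine min_eq_left ?_
      rw [← Nat.cast_mul, ← Fintype.card_prod]
      exact Nat.cast_le.2 hkn
    rw [hmin, he, ← hS]
    exact rectBound_le_finrank hA hB hu hv hul hvl (Finset.card_pos.1 (by omega))

end Rank

theorem mainTheorem12 {mA nA mB nB : ℕ}
    (A : Matrix (Fin mA) (Fin nA) ℂ) (B : Matrix (Fin mB) (Fin nB) ℂ) (σA σB : ℝ → ℝ)
    (hA : IsRankExpansionLowerBound A σA) (hB : IsRankExpansionLowerBound B σB)
    (hA_conc : ConcaveOn ℝ (Ici 0) σA) (hB_conc : ConcaveOn ℝ (Ici 0) σB)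
    (hA_zero : σA 0 = 0) (hB_zero : σB 0 = 0)
    -- `dA` and `dB` are finite, and the intervals `[dA, nA]` and `[dB, nB]` are nonempty
    (hA_bdd : BddAbove {k : ℝ | 0 ≤ k ∧ σA k ≤ 1}) (hA_dom : pseudoInv σA 1 ≤ nA)
    (hB_bdd : BddAbove {k : ℝ | 0 ≤ k ∧ σB k ≤ 1}) (hB_dom : pseudoInv σB 1 ≤ nB)
    (hA_log : LogLogConvexOn (Ioo 0 (nA : ℝ)) (fun x => σA nA - σA (nA - x)))
    (hB_log : LogLogConvexOn (Ioo 0 (nB : ℝ)) (fun x => σB nB - σB (nB - x))) :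
    -- the minima defining `R_C` and `L_C` are attained
    (∀ k ∈ Icc (0 : ℝ) (nA * nB),
      IsLeast (rectValues σA σB nA nB k) (rectBound σA σB nA nB k) ∧
      IsLeast (lshapeValues σA σB nA nB k) (lshapeBound σA σB nA nB k)) ∧
    -- `R_C ≤ L_C` where `R_C` is at least `max rA rB`
    (∀ k ∈ Icc (pseudoInv σA 1 * pseudoInv σB 1) (nA * nB : ℝ),
      max (σA nA) (σB nB) ≤ rectBound σA σB nA nB k →
      rectBound σA σB nA nB k ≤ lshapeBound σA σB nA nB k) ∧
    -- more generally, `R_C ≤ L_C` for `k` at least `max (nA * dB) (dA * nB)`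
    (∀ k ∈ Icc (max (nA * pseudoInv σB 1) (pseudoInv σA 1 * nB)) (nA * nB : ℝ),
      rectBound σA σB nA nB k ≤ lshapeBound σA σB nA nB k) ∧
    -- `R_C`, continued as a constant beyond `nA * nB`, is a rank expansion lower bound
    IsRankExpansionLowerBound (A ⊗ₖ B)
      (fun k => rectBound σA σB nA nB (min k (nA * nB))) ∧
    -- `R_C` is at least as large as the bound without domain restriction
    (∀ k ∈ Icc (0 : ℝ) (nA * nB), prevBound σA σB k ≤ rectBound σA σB nA nB k) := by
  have hu : IsProfile σA nA :=
    ⟨hA.continuousOn, hA.monotoneOn, hA_conc, hA_zero, hA_bdd, hA_dom⟩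
  have hv : IsProfile σB nB :=
    ⟨hB.continuousOn, hB.monotoneOn, hB_conc, hB_zero, hB_bdd, hB_dom⟩
  refine ⟨fun k hk => ⟨isLeast_rectBound hu hv hk.2, isLeast_lshapeBound hu hv hk⟩,
    fun k hk h => ?_, fun k hk => rectBound_le_lshapeBound hu hv hA_log hB_log hk, ?_,
    fun k hk => prevBound_le_rectBound hu hv hk.2⟩
  · obtain ⟨h₁, h₂⟩ := max_le_iff.1 h
    refine rectBound_le_lshapeBound hu hv hA_log hB_log ⟨max_le ?_ ?_, hk.2⟩
    · exact mul_pseudoInv_le_of_le_rectBound hu hv hA_log hk.1 h₁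
    · rw [mul_comm]
      rw [rectBound_comm] at h₂
      exact mul_pseudoInv_le_of_le_rectBound hv hu hB_log (by rw [mul_comm]; exact hk.1) h₂
  · have := isRankExpansionLowerBound_rectBound hA hB (by simpa using hu) (by simpa using hv)
      (by simpa using hA_log) (by simpa using hB_log)
    simpa using this
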